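/- Let $r\ge 1$, $m\ge 0$ and $a=(a_1,\dots,a_m)\in\mathbf Z^m$. Say that $a$ is *reversible mod $d$* if for some $c\in\mathbf Z$ the multisets $\{a_1+c,\dots,a_m+c\}$ and $\{-a_1,\dots,-a_m\}$ agree mod $d$, and that $a$ is *hereditarily good mod $r$* if for every positive divisor $d$ of $r$, either the entries of $a$ are pairwise distinct mod $d$ or $a$ is reversible mod $d$. For $t\ge 1$ put $q=r^2t$, $\omega_q=e^{2\pi i/q}$, $s_i=rta_i+1$, and let $\mathrm{LMR}(r,t,a)\subset U_{2m}$ be the finite cyclic group generated by the diagonal matrix $$\mathrm{diag}(\omega_q^{s_1},\omega_q^{-s_1},\dots,\omega_q^{s_m},\omega_q^{-s_m}).$$ The Hodge series of a finite group $G\subset U_n$ is the rational function $$\Lambda_G(x,y)=\frac1{|G|}\sum_{g\in G}\frac{\det(I_n+yg)}{\det(I_n-xg)}\in\mathbf C(x,y),$$ and two finite groups $G,H\subset U_n$ are Hodge-equivalent if $\Lambda_G=\Lambda_H$. Suppose that $a$ is hereditarily good mod $r$. Then for every $t\ge 1$ the groups $\mathrm{LMR}(r,t,a)$ and $\mathrm{LMR}(r,t,-a)$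 are Hodge-equivalent. If moreover $a$ is not reversible mod $r$, then for every $t\ge1$ these two groups are not conjugate in $GL_{2m}(\mathbf C)$. -/

import Mathlib

open scoped Matrix

noncomputable section

/-! ### Hodge series of finite groups of unitary matrices -/

/-- Polynomials in two variables `x = X 0`, `y = X 1` over `ℂ`. -/
abbrev PolyXY : Type := MvPolynomial (Fin 2) ℂ

/-- The field `ℂ(x, y)` of rational functions in two variables. -/
abbrev RatXY : Type := FractionRing PolyXY

/-- `det (I + y g)` as a polynomial. -/
def hodgeNum {ι : Type*} [Fintype ι] [DecidableEq ι] (g : Matrix ι ι ℂ) : PolyXY :=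
  (1 + (MvPolynomial.X 1 : PolyXY) • g.map (MvPolynomial.C : ℂ →+* PolyXY)).det

/-- `det (I - x g)` as a polynomial; it is never zero, its constant term being `1`. -/
def hodgeDen {ι : Type*} [Fintype ι] [DecidableEq ι] (g : Matrix ι ι ℂ) : PolyXY :=
  (1 - (MvPolynomial.X 0 : PolyXY) • g.map (MvPolynomial.C : ℂ →+* PolyXY)).det

/-- The Hodge series `(1/|G|) ∑_g det (I + y g) / det (I - x g)` of a finite group of unitary
matrices, as a rational function of `x` and `y`. -/
def hodgeSeries {ι : Type*} [Fintype ι] [DecidableEq ι]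
    (G : Subgroup (Matrix.unitaryGroup ι ℂ)) [Finite G] : RatXY :=
  letI := Fintype.ofFinite G
  (Nat.card G : RatXY)⁻¹ *
    ∑ g : G, algebraMap PolyXY RatXY (hodgeNum (g : Matrix.unitaryGroup ι ℂ).1) /
      algebraMap PolyXY RatXY (hodgeDen (g : Matrix.unitaryGroup ι ℂ).1)

/-- Two finite groups of unitary matrices are Hodge-equivalent if their Hodge series agree. -/
def HodgeEquivalent {ι : Type*} [Fintype ι] [DecidableEq ι]
    (G H : Subgroup (Matrix.unitaryGroup ι ℂ)) [Finite G] [Finite H] : Prop :=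
  hodgeSeries G = hodgeSeries H

/-- Conjugacy of groups of unitary matrices within `GL_n(ℂ)`. -/
def ConjugateInGL {ι : Type*} [Fintype ι] [DecidableEq ι]
    (G H : Subgroup (Matrix.unitaryGroup ι ℂ)) : Prop :=
  ∃ P : GL ι ℂ,
    (fun g : Matrix.unitaryGroup ι ℂ => (P : Matrix ι ι ℂ) * g.1 * ((P⁻¹ : GL ι ℂ) : Matrix ι ι ℂ)) ''
        (G : Set (Matrix.unitaryGroup ι ℂ)) =
      (fun h : Matrix.unitaryGroup ι ℂ => h.1) '' (H : Set (Matrix.unitaryGroup ι ℂ))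

/-! ### Cyclic groups of diagonal matrices -/

/-- `ω_q = exp(2πi/q)`. -/
def rootOmega (q : ℕ) : ℂ := Complex.exp (2 * Real.pi * Complex.I / q)

theorem star_rootOmega_mul (q : ℕ) : star (rootOmega q) * rootOmega q = 1 := by
  rw [rootOmega, Complex.star_def, ← Complex.exp_conj, ← Complex.exp_add]
  have h2 : (starRingEnd ℂ) 2 = 2 := Complex.conj_ofNat 2
  simp [neg_div, h2]

theorem rootOmega_pow (q : ℕ) : rootOmega q ^ q = 1 := by
  rcases Nat.eq_zero_or_pos q with rfl | h
  · simp
  · exact (Complex.isPrimitiveRoot_exp q h.ne').pow_eq_one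

/-- The unitary matrix `diag(ω_q^{s_i})`. -/
def diagOmega {ι : Type*} [Fintype ι] [DecidableEq ι] (q : ℕ) (s : ι → ℤ) :
    Matrix.unitaryGroup ι ℂ :=
  ⟨Matrix.diagonal fun i => rootOmega q ^ s i, by
    rw [Matrix.mem_unitaryGroup_iff', Matrix.star_eq_conjTranspose,
      Matrix.diagonal_conjTranspose, Matrix.diagonal_mul_diagonal, ← Matrix.diagonal_one]
    congr 1
    funext i
    rw [Pi.star_apply, star_zpow₀, ← mul_zpow, star_rootOmega_mul, one_zpow]⟩

/-- The cyclic group `L(q, s)` generated by `diag(ω_q^{s_i})`. -/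
def cyclicL {ι : Type*} [Fintype ι] [DecidableEq ι] (q : ℕ) (s : ι → ℤ) :
    Subgroup (Matrix.unitaryGroup ι ℂ) :=
  Subgroup.zpowers (diagOmega q s)

/-- The doubled list `(s₁, -s₁, …, s_m, -s_m)`; the pair `(i, 0)` indexes `s_i` and
`(i, 1)` indexes `-s_i`. -/
def dub {m : ℕ} (s : Fin m → ℤ) : Fin m × Fin 2 → ℤ :=
  fun p => if p.2 = 0 then s p.1 else -s p.1

/-- `L^±(q, s) = L(q, (s₁, -s₁, …, s_m, -s_m))`, a group of `2m × 2m` unitary matrices. -/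
def cyclicLpm {m : ℕ} (q : ℕ) (s : Fin m → ℤ) :
    Subgroup (Matrix.unitaryGroup (Fin m × Fin 2) ℂ) :=
  cyclicL q (dub s)

/-- `LMR(r, t, a) = L^±(r² t, r t a + 1)`. -/
def LMR {m : ℕ} (r t : ℕ) (a : Fin m → ℤ) :
    Subgroup (Matrix.unitaryGroup (Fin m × Fin 2) ℂ) :=
  cyclicLpm (r ^ 2 * t) fun i => (r : ℤ) * t * a i + 1

instance finite_cyclicL {ι : Type*} [Fintype ι] [DecidableEq ι] (q : ℕ) (s : ι → ℤ) :
    Finite (cyclicL q s) := by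
  have h : ∃ n : ℕ, 0 < n ∧ rootOmega q ^ n = 1 := by
    rcases Nat.eq_zero_or_pos q with rfl | h
    · exact ⟨1, one_pos, by simp [rootOmega]⟩
    · exact ⟨q, h, rootOmega_pow q⟩
  obtain ⟨n, hn, hq⟩ := h
  have key : diagOmega q s ^ n = 1 := by
    apply Subtype.ext
    change (Matrix.diagonal fun i => rootOmega q ^ s i) ^ n = 1
    rw [Matrix.diagonal_pow, ← Matrix.diagonal_one]
    congr 1
    funext i
    rw [Pi.pow_apply, ← zpow_natCast, zpow_comm, zpow_natCast, hq, one_zpow]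
  exact (isOfFinOrder_iff_pow_eq_one.2 ⟨n, hn, key⟩).finite_zpowers

instance finite_LMR {m : ℕ} (r t : ℕ) (a : Fin m → ℤ) : Finite (LMR r t a) :=
  finite_cyclicL _ _

/-! ### Conditions on integer vectors -/

/-- For some integer `c`, `a + c` and `b` are the same as multisets mod `r`. -/
def ShiftEqMod {m : ℕ} (r : ℕ) (a b : Fin m → ℤ) : Prop :=
  ∃ c : ℤ, (Finset.univ.val.map fun i => ((a i + c : ℤ) : ZMod r)) =
    Finset.univ.val.map fun i => ((b i : ℤ) : ZMod r)

/-- The entries of `a` are distinct mod `r`. -/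
def UnivalentMod {m : ℕ} (r : ℕ) (a : Fin m → ℤ) : Prop :=
  Function.Injective fun i => ((a i : ℤ) : ZMod r)

/-- `a` and `-a` agree mod `r` as multisets, up to a common shift. -/
def ReversibleMod {m : ℕ} (r : ℕ) (a : Fin m → ℤ) : Prop :=
  ShiftEqMod r a (-a)

/-- Univalent or reversible mod `r`. -/
def GoodMod {m : ℕ} (r : ℕ) (a : Fin m → ℤ) : Prop :=
  UnivalentMod r a ∨ ReversibleMod r a

/-- Good mod every divisor of `r`. -/
def HereditarilyGoodMod {m : ℕ} (r : ℕ) (a : Fin m → ℤ) : Prop :=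
  ∀ d : ℕ, d ∣ r → GoodMod d a

end

/-!
Put `u = r t` in `ℤ/r²t`, so that `u² = 0`. With `ω = ω_q`, the Hodge series of
`LMR(r, t, a)` is the average over `k` of `∏ i, hodgeFactor (ω ^ (k (u a i + 1)))`. The `k` for
which `k u` has additive order `n`, a divisor of `r`, are permuted by the units `1 + u c`, which
shift `a` by `c`. Hence if `a` is reversible mod `n`, their contribution does not change when `a`
is replaced by `-a`. If instead the entries of `a` are distinct mod `n`, averaging over all
shifts turns the contribution of `k` into the average of a rational function of `z = ω ^ k` over
the rotations `z ↦ ζ z` with `ζ ^ n = 1`. Over a common denominator, its numerator is a product of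
`n` palindromic quadratic polynomials; averaging kills every coefficient except those of degree
`0`, `n` and `2n`, and the outer two agree, so `z` may be replaced by `z⁻¹`, which again amounts to
replacing `a` by `-a`.

If the two groups are conjugate, comparing eigenvalues gives a scalar `k` carrying the exponents
`± (u b i + 1)` to `± (u a i + 1)`. When `r t > 2` the signs are told apart modulo `r t`, and what
remains says that `b` is a shift of `a` mod `r`.
-/

section Averaging

-- All fibres of `φ` over its range have the same size.
theorem inv_card_mul_sum_range {G H K : Type*} [Group G] [Fintype G] [Group H] [Field K]
    [CharZero K] (φ : G →* H) [Fintype φ.range] (f : H → K) :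
    (Nat.card φ.range : K)⁻¹ * ∑ h : φ.range, f h = (Fintype.card G : K)⁻¹ * ∑ g, f (φ g) := by
  classical
  have hfibre : ∀ h : φ.range, (Finset.univ.filter fun g => φ.rangeRestrict g = h).card =
      (Finset.univ.filter fun g => φ.rangeRestrict g = 1).card := fun h =>
    MonoidHom.card_fiber_eq_of_mem_range _ (φ.rangeRestrict_surjective h) ⟨1, map_one _⟩
  set N := (Finset.univ.filter fun g => φ.rangeRestrict g = 1).card
  have hsum : ∀ F : φ.range → K, ∑ g, F (φ.rangeRestrict g) = N * ∑ h, F h := fun F => by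
    rw [← Finset.sum_fiberwise Finset.univ φ.rangeRestrict, Finset.mul_sum]
    refine Finset.sum_congr rfl fun h _ => ?_
    rw [Finset.sum_congr rfl fun g hg => congrArg F (Finset.mem_filter.1 hg).2, Finset.sum_const,
      hfibre, nsmul_eq_mul]
  have hcard : (Fintype.card G : K) = N * Nat.card φ.range := by
    rw [Nat.card_eq_fintype_card]
    simpa using hsum fun _ => 1
  have hN : (N : K) ≠ 0 := left_ne_zero_of_mul (hcard ▸ Nat.cast_ne_zero.2 Fintype.card_ne_zero)
  have hsumf : ∑ g, f (φ g) = N * ∑ h : φ.range, f h := hsum fun h => f h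
  rw [hsumf, hcard]
  field_simp

end Averaging

section Rotation

open Polynomial

theorem prod_addChar_sq {A M : Type*} [AddCommGroup A] [Fintype A] [CommMonoid M]
    (χ : AddChar A M) : ∏ l, χ l ^ 2 = 1 := by
  have hneg : ∏ l, χ (-l) = ∏ l, χ l := Equiv.prod_comp (Equiv.neg A) χ
  calc ∏ l, χ l ^ 2 = ∏ l, χ l * χ (-l) := by
        simp only [sq, Finset.prod_mul_distrib, hneg]
    _ = 1 := Finset.prod_eq_one fun l _ => by
        rw [← AddChar.map_add_eq_mul, add_neg_cancel, AddChar.map_zero_eq_one]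

variable {K : Type*} [Field K] {n : ℕ} [NeZero n] {χ : AddChar (ZMod n) K}

theorem sum_addChar_pow (hχ : IsPrimitiveRoot (χ 1) n) (i : ℕ) :
    ∑ j, χ j ^ i = if n ∣ i then (n : K) else 0 := by
  have htriv : i • χ = 0 ↔ n ∣ i := by
    rw [← hχ.pow_eq_one_iff_dvd, ← AddChar.nsmul_apply]
    exact not_iff_not.1 (AddChar.zmod_char_ne_one_iff n (i • χ))
  simpa only [AddChar.nsmul_apply, htriv, ZMod.card] using AddChar.sum_eq_ite (i • χ)

theorem sum_eval_addChar_mul (hχ : IsPrimitiveRoot (χ 1) n) {Q : K[X]} {d : ℕ}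
    (hQ : Q.natDegree ≤ n * d) (z : K) :
    ∑ j, Q.eval (χ j * z) =
      n * ∑ k ∈ Finset.range (d + 1), Q.coeff (n * k) * z ^ (n * k) := by
  have hmultiples : (Finset.range (n * d + 1)).filter (n ∣ ·) =
      (Finset.range (d + 1)).image (n * ·) := by
    ext i
    simp only [Finset.mem_filter, Finset.mem_range, Finset.mem_image, Nat.lt_succ_iff]
    constructor
    · rintro ⟨hi, k, rfl⟩
      exact ⟨k, Nat.le_of_mul_le_mul_left hi (NeZero.pos n), rfl⟩
    · rintro ⟨k, hk, rfl⟩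
      exact ⟨Nat.mul_le_mul_left n hk, dvd_mul_right n k⟩
  calc ∑ j, Q.eval (χ j * z)
      = ∑ j, ∑ i ∈ Finset.range (n * d + 1), Q.coeff i * z ^ i * χ j ^ i := by
        refine Finset.sum_congr rfl fun j _ => ?_
        rw [eval_eq_sum_range' (Nat.lt_succ_of_le hQ)]
        exact Finset.sum_congr rfl fun i _ => by ring
    _ = ∑ i ∈ Finset.range (n * d + 1), if n ∣ i then Q.coeff i * z ^ i * n else 0 := by
        rw [Finset.sum_comm]
        simp only [← Finset.mul_sum, sum_addChar_pow hχ, mul_ite, mul_zero]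
    _ = n * ∑ k ∈ Finset.range (d + 1), Q.coeff (n * k) * z ^ (n * k) := by
        rw [← Finset.sum_filter, hmultiples,
          Finset.sum_image (mul_right_injective₀ (NeZero.ne n)).injOn, ← Finset.sum_mul, mul_comm]

theorem sum_eval_addChar_mul_inv (hχ : IsPrimitiveRoot (χ 1) n) {Q : K[X]}
    (hdeg : Q.natDegree ≤ n * 2) (hcoeff : Q.coeff 0 = Q.coeff (n * 2)) {z : K} (hz : z ≠ 0) :
    ∑ j, Q.eval (χ j * z) = z ^ (n * 2) * ∑ j, Q.eval (χ j * z⁻¹) := by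
  simp only [sum_eval_addChar_mul hχ hdeg, Finset.sum_range_succ, Finset.sum_range_zero, mul_zero,
    mul_one, hcoeff, pow_zero, inv_pow]
  field_simp
  ring

/-- Self-reciprocal polynomials `b X² + c X + b`; `b = 0` is allowed. -/
structure IsPalindromicQuadratic (P : K[X]) : Prop where
  natDegree_le : P.natDegree ≤ 2
  coeff_zero_eq : P.coeff 0 = P.coeff 2

theorem sum_prod_eval_rotate_inv (hχ : IsPrimitiveRoot (χ 1) n) {P : ZMod n → K[X]}
    (hP : ∀ l, IsPalindromicQuadratic (P l)) {z : K} (hz : z ≠ 0) :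
    ∑ j, ∏ l, (P l).eval (χ (l + j) * z) =
      z ^ (n * 2) * ∑ j, ∏ l, (P l).eval (χ (l + j) * z⁻¹) := by
  have hrot : ∀ l, ((P l).comp (C (χ l) * X)).natDegree ≤ 2 := fun l =>
    natDegree_comp_le.trans <| (Nat.mul_le_mul (hP l).natDegree_le
      ((natDegree_C_mul_le _ _).trans natDegree_X_le)).trans_eq (mul_one 2)
  have hcard : n * 2 = (Finset.univ : Finset (ZMod n)).card * 2 := by
    rw [Finset.card_univ, ZMod.card]
  have heval : ∀ w j, ∏ l, (P l).eval (χ (l + j) * w) =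
      (∏ l, (P l).comp (C (χ l) * X)).eval (χ j * w) := fun w j => by
    simp [eval_prod, AddChar.map_add_eq_mul, mul_assoc]
  simp only [heval]
  refine sum_eval_addChar_mul_inv hχ ?_ ?_ hz
  · rw [hcard]
    exact (natDegree_prod_le _ _).trans (Finset.sum_le_card_nsmul _ _ _ fun l _ => hrot l)
  · rw [hcard, coeff_prod_of_natDegree_le _ _ _ fun l _ => hrot l, coeff_zero_prod]
    simp only [comp_C_mul_X_coeff, pow_zero, mul_one, Finset.prod_mul_distrib, prod_addChar_sq,
      (hP _).coeff_zero_eq]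

theorem prod_eval_rotate (χ : AddChar (ZMod n) K) (P : K[X]) (j : ZMod n) (z : K) :
    ∏ l, P.eval (χ (l + j) * z) = ∏ l, P.eval (χ l * z) :=
  Equiv.prod_comp (Equiv.addRight j) fun l => P.eval (χ l * z)

theorem prod_eval_rotate_inv (hχ : IsPrimitiveRoot (χ 1) n) {P : K[X]}
    (hP : IsPalindromicQuadratic P) {z : K} (hz : z ≠ 0) :
    ∏ l, P.eval (χ l * z) = z ^ (n * 2) * ∏ l, P.eval (χ l * z⁻¹) := by
  have hsum := sum_prod_eval_rotate_inv hχ (fun _ => hP) hz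
  have hn : (n : K) ≠ 0 := hχ.neZero'.ne
  simp only [prod_eval_rotate, Finset.sum_const, Finset.card_univ, ZMod.card, nsmul_eq_mul] at hsum
  rw [mul_left_comm] at hsum
  exact mul_left_cancel₀ hn hsum

theorem prod_div_eq_prod_ite_div {ι κ K : Type*} [Fintype ι] [Fintype κ] [Field K] {a : ι → κ}
    (ha : Function.Injective a) [DecidablePred (· ∈ Set.range a)] (f g : κ → K)
    (hg : ∀ l, g l ≠ 0) :
    ∏ i, f (a i) / g (a i) = (∏ l, if l ∈ Set.range a then f l else g l) / ∏ l, g l := by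
  classical
  rw [← Finset.prod_div_distrib, ← Finset.prod_image (s := Finset.univ) (g := a)
    (f := fun l => f l / g l) ha.injOn]
  refine (Finset.prod_congr rfl fun l hl => ?_).trans
    (Finset.prod_subset (Finset.subset_univ _) fun l _ hl => ?_)
  · rw [if_pos (by simpa using hl)]
  · rw [if_neg (by simpa using hl), div_self (hg l)]

theorem sum_prod_div_rotate_inv {ι : Type*} [Fintype ι] (hχ : IsPrimitiveRoot (χ 1) n)
    {N D : K[X]} (hN : IsPalindromicQuadratic N) (hD : IsPalindromicQuadratic D)
    {a : ι → ZMod n} (ha : Function.Injective a) {z : K} (hz : z ≠ 0)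
    (hDz : ∀ l, D.eval (χ l * z) ≠ 0) :
    ∑ j, ∏ i, N.eval (χ (a i + j) * z) / D.eval (χ (a i + j) * z) =
      ∑ j, ∏ i, N.eval (χ (a i + j) * z⁻¹) / D.eval (χ (a i + j) * z⁻¹) := by
  classical
  let P : ZMod n → K[X] := fun l => if l ∈ Set.range a then N else D
  have hP : ∀ l, IsPalindromicQuadratic (P l) := fun l => by
    by_cases hl : l ∈ Set.range a <;> simp only [P, hl, if_true, if_false, hN, hD]
  have hdenom := prod_eval_rotate_inv hχ hD hz
  have hDz' : ∀ l, D.eval (χ l * z⁻¹) ≠ 0 := fun l =>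
    Finset.prod_ne_zero_iff.1 (right_ne_zero_of_mul
      (hdenom ▸ Finset.prod_ne_zero_iff.2 fun l _ => hDz l)) l (Finset.mem_univ l)
  have hcommon : ∀ w, (∀ l, D.eval (χ l * w) ≠ 0) →
      ∑ j, ∏ i, N.eval (χ (a i + j) * w) / D.eval (χ (a i + j) * w) =
        (∑ j, ∏ l, (P l).eval (χ (l + j) * w)) / ∏ l, D.eval (χ l * w) := by
    intro w hw
    rw [Finset.sum_div]
    refine Finset.sum_congr rfl fun j _ => ?_
    rw [prod_div_eq_prod_ite_div ha (fun l => N.eval (χ (l + j) * w))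
      (fun l => D.eval (χ (l + j) * w)) fun l => hw (l + j),
      prod_eval_rotate]
    simp only [P, apply_ite (eval _)]
  rw [hcommon z hDz, hcommon z⁻¹ hDz', sum_prod_eval_rotate_inv hχ hP hz, hdenom,
    mul_div_mul_left _ _ (pow_ne_zero _ hz)]

end Rotation

section HodgeFactor

open Polynomial

variable {K : Type*} [Field K]

/-- The factor `(1 + yz)(1 + y/z) / ((1 - xz)(1 - x/z))` that a pair of eigenvalues `z, z⁻¹`
contributes to a summand of the Hodge series. -/
noncomputable def hodgeFactor (x y z : K) : K :=
  (1 + y * z) * (1 + y * z⁻¹) / ((1 - x * z) * (1 - x * z⁻¹))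

theorem hodgeFactor_inv (x y z : K) : hodgeFactor x y z⁻¹ = hodgeFactor x y z := by
  simp only [hodgeFactor, inv_inv, mul_comm]

theorem isPalindromicQuadratic_mul (c : K) :
    IsPalindromicQuadratic ((1 + C c * X) * (X + C c)) := by
  have hexpand : (1 + C c * X) * (X + C c) = C c * X ^ 2 + C (1 + c ^ 2) * X + C c := by
    simp only [C_add, C_pow, C_1]
    ring
  rw [hexpand]
  exact ⟨natDegree_quadratic_le, by
    simp [-map_add, coeff_X, coeff_C]⟩

theorem hodgeFactor_eq_eval_div_eval (x y : K) {z : K} (hz : z ≠ 0) :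
    hodgeFactor x y z = ((1 + C y * X) * (X + C y)).eval z /
      ((1 + C (-x) * X) * (X + C (-x))).eval z := by
  have hclear : ∀ c : K, (1 + c * z) * (z + c) = (1 + c * z) * (1 + c * z⁻¹) * z := fun c => by
    field_simp
  simp only [eval_mul, eval_add, eval_one, eval_C, eval_X]
  rw [hclear, hclear, mul_div_mul_right _ _ hz]
  simp only [hodgeFactor, neg_mul, ← sub_eq_add_neg]

theorem sum_prod_hodgeFactor_rotate_inv {ι : Type*} [Fintype ι] {n : ℕ} [NeZero n]
    {χ : AddChar (ZMod n) K} (hχ : IsPrimitiveRoot (χ 1) n) (x y : K) {a : ι → ZMod n}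
    (ha : Function.Injective a) {z : K} (hz : z ≠ 0) (hpos : ∀ l, 1 - x * (χ l * z) ≠ 0)
    (hneg : ∀ l, 1 - x * (χ l * z⁻¹) ≠ 0) :
    ∑ j, ∏ i, hodgeFactor x y (χ (a i + j) * z) =
      ∑ j, ∏ i, hodgeFactor x y (χ (a i + j) * z⁻¹) := by
  have hχz : ∀ l {w : K}, w ≠ 0 → χ l * w ≠ 0 := fun l _ => mul_ne_zero (χ.val_isUnit l).ne_zero
  simp only [hodgeFactor_eq_eval_div_eval x y (hχz _ hz),
    hodgeFactor_eq_eval_div_eval x y (hχz _ (inv_ne_zero hz))]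
  refine sum_prod_div_rotate_inv hχ (isPalindromicQuadratic_mul y)
    (isPalindromicQuadratic_mul (-x)) ha hz fun l => ?_
  have hfactor : χ l * z - x = (1 - x * (χ (-l) * z⁻¹)) * (χ l * z) := by
    rw [AddChar.map_neg_eq_inv, ← mul_inv, sub_mul, one_mul, mul_assoc,
      inv_mul_cancel₀ (hχz l hz), mul_one]
  simp only [eval_mul, eval_add, eval_one, eval_C, eval_X, neg_mul, ← sub_eq_add_neg, hfactor]
  exact mul_ne_zero (hpos l) (mul_ne_zero (hneg (-l)) (hχz l hz))

end HodgeFactor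

section MultiplesAddChar

/-- The character `b ↦ ψ (b v)` of `ℤ`, which factors through the order of `v`. -/
noncomputable def multiplesAddChar {A M : Type*} [AddGroup A] [Monoid M] (ψ : AddChar A M) (v : A) :
    AddChar (ZMod (addOrderOf v)) M :=
  ψ.compAddMonoidHom (ZMod.lift _ ⟨zmultiplesHom A v, by simp⟩)

theorem multiplesAddChar_intCast {A M : Type*} [AddGroup A] [Monoid M] (ψ : AddChar A M)
    (v : A) (b : ℤ) : multiplesAddChar ψ v b = ψ (b • v) := by
  simp [multiplesAddChar]

theorem isPrimitiveRoot_multiplesAddChar_one {A M : Type*} [AddGroup A] [CommMonoid M]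
    {ψ : AddChar A M} (hψ : Function.Injective ψ) (v : A) :
    IsPrimitiveRoot (multiplesAddChar ψ v 1) (addOrderOf v) := by
  have hone : multiplesAddChar ψ v 1 = ψ v := by simpa using multiplesAddChar_intCast ψ v 1
  have hpow : ∀ l : ℕ, ψ v ^ l = 1 ↔ addOrderOf v ∣ l := fun l => by
    rw [← AddChar.map_nsmul_eq_pow, ← AddChar.map_zero_eq_one ψ, hψ.eq_iff,
      addOrderOf_dvd_iff_nsmul_eq_zero]
  rw [hone, IsPrimitiveRoot.iff_def]
  exact ⟨(hpow _).2 dvd_rfl, fun l => (hpow l).1⟩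

theorem sum_prod_hodgeFactor_neg_of_injective {R ι K : Type*} [CommRing R] [Fintype ι] [Field K]
    {ψ : AddChar R K} (hψ : Function.Injective ψ) {x : K} (hx : ∀ v, 1 - x * ψ v ≠ 0) (y : K)
    {k u : R} {n : ℕ} [NeZero n] (hn : addOrderOf (k * u) = n) {a : ι → ℤ}
    (ha : Function.Injective fun i => (a i : ZMod n)) :
    ∑ j : ZMod n, ∏ i, hodgeFactor x y (ψ (k * (u * (-a i + j.val : ℤ) + 1))) =
      ∑ j : ZMod n, ∏ i, hodgeFactor x y (ψ (k * (u * (a i + j.val : ℤ) + 1))) := by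
  subst hn
  set χ := multiplesAddChar ψ (k * u)
  have hsplit : ∀ (b : ℤ) (j : ZMod (addOrderOf (k * u))),
      ψ (k * (u * (b + j.val : ℤ) + 1)) = χ (b + j) * ψ k := fun b j => by
    have hcast : (b + j : ZMod (addOrderOf (k * u))) = ((b + j.val : ℤ) : ZMod _) := by
      push_cast
      rw [ZMod.natCast_zmod_val]
    rw [hcast, multiplesAddChar_intCast, ← AddChar.map_add_eq_mul, zsmul_eq_mul]
    congr 1
    ring
  have hχψ : ∀ l v, ∃ w, χ l * ψ v = ψ w := fun l v =>
    ⟨_, (AddChar.map_add_eq_mul ψ _ v).symm⟩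
  have hnonzero : ∀ l v, 1 - x * (χ l * ψ v) ≠ 0 := fun l v => by
    obtain ⟨w, hw⟩ := hχψ l v
    exact hw ▸ hx w
  simp only [hsplit]
  calc ∑ j, ∏ i, hodgeFactor x y (χ ((-a i : ℤ) + j) * ψ k)
      = ∑ j, ∏ i, hodgeFactor x y (χ (a i + j) * (ψ k)⁻¹) := by
        refine Fintype.sum_equiv (Equiv.neg _) _ _ fun j => Finset.prod_congr rfl fun i _ => ?_
        rw [← hodgeFactor_inv, mul_inv, ← AddChar.map_neg_eq_inv χ]
        congr 3
        push_cast
        rw [Equiv.neg_apply, neg_add, neg_neg]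
    _ = ∑ j, ∏ i, hodgeFactor x y (χ (a i + j) * ψ k) :=
        (sum_prod_hodgeFactor_rotate_inv (isPrimitiveRoot_multiplesAddChar_one hψ _) x y ha
          (ψ.val_isUnit k).ne_zero (fun l => hnonzero l k)
          fun l => by rw [← AddChar.map_neg_eq_inv]; exact hnonzero l (-k)).symm

end MultiplesAddChar

section OrderSum

theorem map_univ_eq_map_univ_iff {ι α : Type*} [Fintype ι] {f g : ι → α} :
    Finset.univ.val.map f = Finset.univ.val.map g ↔ ∃ σ : Equiv.Perm ι, ∀ i, g (σ i) = f i := by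
  classical
  constructor
  · intro h
    have hfibre : ∀ c, Nonempty ({i // f i = c} ≃ {i // g i = c}) := fun c => by
      refine ⟨Fintype.equivOfCardEq ?_⟩
      have hcount := congrArg (Multiset.count c) h
      simp only [Multiset.count_map, eq_comm (a := c)] at hcount
      simp only [Fintype.card_subtype]
      exact hcount
    exact ⟨Equiv.ofFiberEquiv fun c => (hfibre c).some, Equiv.ofFiberEquiv_map _⟩
  · rintro ⟨σ, hσ⟩
    obtain rfl : g ∘ σ = f := funext hσ
    rw [← Multiset.map_map, Multiset.map_univ_val_equiv]

variable {R ι : Type*} [CommRing R] [Fintype R] [Fintype ι]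

/-- The part of `∑ k, ∏ i, f (k * (u * a i + 1))` coming from the `k` for which `k * u` has
additive order `n`. -/
noncomputable def orderSum {M : Type*} [CommSemiring M] (f : R → M) (u : R) (n : ℕ)
    (a : ι → ℤ) : M :=
  ∑ k with addOrderOf (k * u) = n, ∏ i, f (k * (u * a i + 1))

theorem sum_prod_eq_sum_orderSum {M : Type*} [CommSemiring M] (f : R → M) {u : R} {r : ℕ}
    (hr : r ≠ 0) (hru : r * u = 0) (a : ι → ℤ) :
    ∑ k, ∏ i, f (k * (u * a i + 1)) = ∑ n ∈ r.divisors, orderSum f u n a := by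
  refine (Finset.sum_fiberwise_of_maps_to (fun k _ => ?_) _).symm
  refine Nat.mem_divisors.2 ⟨addOrderOf_dvd_of_nsmul_eq_zero ?_, hr⟩
  rw [nsmul_eq_mul, mul_left_comm, hru, mul_zero]

theorem orderSum_congr {M : Type*} [CommSemiring M] (f : R → M) (u : R) {n : ℕ} {a b : ι → ℤ}
    (h : (Finset.univ.val.map fun i => (a i : ZMod n)) =
      Finset.univ.val.map fun i => (b i : ZMod n)) :
    orderSum f u n a = orderSum f u n b := by
  obtain ⟨σ, hσ⟩ := map_univ_eq_map_univ_iff.1 h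
  refine Finset.sum_congr rfl fun k hk => Fintype.prod_equiv σ _ _ fun i => congrArg f ?_
  have hdvd : (addOrderOf (k * u) : ℤ) ∣ b (σ i) - a i := by
    rw [(Finset.mem_filter.1 hk).2, ← ZMod.intCast_eq_intCast_iff_dvd_sub, hσ]
  rw [addOrderOf_dvd_iff_zsmul_eq_zero, zsmul_eq_mul] at hdvd
  push_cast at hdvd
  linear_combination -hdvd

-- Since `u² = 0`, multiplying `k` by the unit `1 + u c` fixes `k * u` and adds `c` to `a`.
theorem orderSum_add_intCast {M : Type*} [CommSemiring M] (f : R → M) {u : R} (hu : u * u = 0)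
    (n : ℕ) (a : ι → ℤ) (c : ℤ) :
    orderSum f u n (fun i => a i + c) = orderSum f u n a := by
  let w : Rˣ := ⟨1 + u * c, 1 - u * c, by linear_combination -c * c * hu,
    by linear_combination -c * c * hu⟩
  refine Finset.sum_equiv (Units.mulRight w) (fun k => ?_) fun k _ =>
    Finset.prod_congr rfl fun i _ => congrArg f ?_
  · have hfix : k * w * u = k * u := by linear_combination k * c * hu
    simp [hfix]
  · simp only [Units.mulRight_apply, w]
    push_cast
    linear_combination -k * c * a i * hu

theorem orderSum_neg_of_reversibleMod {M : Type*} [CommSemiring M] (f : R → M) {u : R}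
    (hu : u * u = 0) {m n : ℕ} {a : Fin m → ℤ} (ha : ReversibleMod n a) :
    orderSum f u n (-a) = orderSum f u n a := by
  obtain ⟨c, hc⟩ := ha
  rw [← orderSum_add_intCast f hu n a c, orderSum_congr f u hc]

theorem natCast_mul_orderSum {M : Type*} [CommSemiring M] (f : R → M) {u : R} (hu : u * u = 0)
    (n : ℕ) [NeZero n] (a : ι → ℤ) :
    n * orderSum f u n a = ∑ k with addOrderOf (k * u) = n,
      ∑ j : ZMod n, ∏ i, f (k * (u * (a i + j.val : ℤ) + 1)) := by
  rw [Finset.sum_comm]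
  change _ = ∑ j : ZMod n, orderSum f u n fun i => a i + (j.val : ℤ)
  simp [orderSum_add_intCast f hu]

variable {K : Type*} [Field K] {ψ : AddChar R K} {x : K}

theorem orderSum_neg_of_univalentMod (hψ : Function.Injective ψ) (hx : ∀ v, 1 - x * ψ v ≠ 0)
    (y : K) {u : R} (hu : u * u = 0) {m n : ℕ} (hn : (n : K) ≠ 0) {a : Fin m → ℤ}
    (ha : UnivalentMod n a) :
    orderSum (fun v => hodgeFactor x y (ψ v)) u n (-a) =
      orderSum (fun v => hodgeFactor x y (ψ v)) u n a := by
  have : NeZero n := ⟨fun h => hn (by simp [h])⟩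
  refine mul_left_cancel₀ hn ?_
  rw [natCast_mul_orderSum _ hu, natCast_mul_orderSum _ hu]
  exact Finset.sum_congr rfl fun k hk =>
    sum_prod_hodgeFactor_neg_of_injective hψ hx y (Finset.mem_filter.1 hk).2 ha

theorem sum_prod_hodgeFactor_neg (hψ : Function.Injective ψ) (hx : ∀ v, 1 - x * ψ v ≠ 0)
    (y : K) {u : R} (hu : u * u = 0) {m r : ℕ} (hr : (r : K) ≠ 0) (hru : r * u = 0)
    {a : Fin m → ℤ} (ha : HereditarilyGoodMod r a) :
    ∑ k, ∏ i, hodgeFactor x y (ψ (k * (u * (-a) i + 1))) =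
      ∑ k, ∏ i, hodgeFactor x y (ψ (k * (u * a i + 1))) := by
  have hr₀ : r ≠ 0 := by
    rintro rfl
    exact hr Nat.cast_zero
  have hsum := sum_prod_eq_sum_orderSum (ι := Fin m) (fun v => hodgeFactor x y (ψ v)) hr₀ hru
  rw [hsum, hsum]
  refine Finset.sum_congr rfl fun n hn => ?_
  have hdvd := Nat.dvd_of_mem_divisors hn
  rcases ha n hdvd with huniv | hrev
  · exact orderSum_neg_of_univalentMod hψ hx y hu
      (ne_zero_of_dvd_ne_zero hr (Nat.cast_dvd_cast hdvd)) huniv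
  · exact orderSum_neg_of_reversibleMod _ hu hrev

end OrderSum

section HodgeSeries

variable {ι : Type*} [Fintype ι] [DecidableEq ι]

theorem rootOmega_zpow_eq_stdAddChar {q : ℕ} [NeZero q] (j : ℤ) :
    rootOmega q ^ j = ZMod.stdAddChar (j : ZMod q) := by
  rw [ZMod.stdAddChar_coe, rootOmega, ← Complex.exp_int_mul]
  congr 1
  ring

theorem coe_diagOmega {q : ℕ} [NeZero q] (s : ι → ℤ) :
    (diagOmega q s : Matrix ι ι ℂ) = Matrix.diagonal fun i => ZMod.stdAddChar (s i : ZMod q) := by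
  simp only [diagOmega, rootOmega_zpow_eq_stdAddChar]

/-- The parametrization `k ↦ diag(ω_q^{k s_i})` of `L(q, s)` by `ℤ/q`, which need not be
injective. -/
noncomputable def diagOmegaChar (q : ℕ) [NeZero q] (s : ι → ℤ) :
    AddChar (ZMod q) (Matrix.unitaryGroup ι ℂ) where
  toFun k := diagOmega q fun i => k.val * s i
  map_zero_eq_one' := by
    rw [← Subtype.val_inj, coe_diagOmega]
    simp
  map_add_eq_mul' k l := by
    rw [← Subtype.val_inj, Submonoid.coe_mul]
    simp [coe_diagOmega, add_mul, AddChar.map_add_eq_mul]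

theorem coe_diagOmegaChar {q : ℕ} [NeZero q] (s : ι → ℤ) (k : ZMod q) :
    (diagOmegaChar q s k : Matrix ι ι ℂ) =
      Matrix.diagonal fun i => ZMod.stdAddChar (k * (s i : ZMod q)) := by
  refine (coe_diagOmega _).trans ?_
  simp

theorem range_diagOmegaChar (q : ℕ) [NeZero q] (s : ι → ℤ) :
    (diagOmegaChar q s).toMonoidHom.range = cyclicL q s := by
  have hone : diagOmegaChar q s 1 = diagOmega q s := by
    rw [← Subtype.val_inj, coe_diagOmegaChar, coe_diagOmega]
    simp
  refine le_antisymm ?_ ?_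
  · rintro _ ⟨k, rfl⟩
    refine ⟨k.toAdd.val, ?_⟩
    simp only [← hone, ← AddChar.map_zsmul_eq_zpow]
    simp
  · rw [cyclicL, Subgroup.zpowers_le]
    exact ⟨Multiplicative.ofAdd 1, hone⟩

theorem hodgeSeries_eq_of_range_eq {A : Type*} [AddGroup A] [Fintype A]
    (χ : AddChar A (Matrix.unitaryGroup ι ℂ)) {H : Subgroup (Matrix.unitaryGroup ι ℂ)} [Finite H]
    (hχ : χ.toMonoidHom.range = H) :
    hodgeSeries H = (Fintype.card A : RatXY)⁻¹ *
      ∑ k, algebraMap PolyXY RatXY (hodgeNum (χ k).1) /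
        algebraMap PolyXY RatXY (hodgeDen (χ k).1) := by
  subst hχ
  let := Fintype.ofFinite χ.toMonoidHom.range
  refine (inv_card_mul_sum_range χ.toMonoidHom fun h =>
    algebraMap PolyXY RatXY (hodgeNum h.1) / algebraMap PolyXY RatXY (hodgeDen h.1)).trans ?_
  rw [Fintype.card_multiplicative]
  exact congrArg _ (Fintype.sum_equiv Multiplicative.toAdd _ _ fun _ => rfl)

theorem hodgeNum_diagonal (d : ι → ℂ) :
    hodgeNum (Matrix.diagonal d) = ∏ i, (1 + MvPolynomial.X 1 * MvPolynomial.C (d i)) := by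
  rw [hodgeNum, Matrix.diagonal_map (map_zero _), ← Matrix.diagonal_smul, ← Matrix.diagonal_one,
    Matrix.diagonal_add, Matrix.det_diagonal]
  rfl

theorem hodgeDen_diagonal (d : ι → ℂ) :
    hodgeDen (Matrix.diagonal d) = ∏ i, (1 - MvPolynomial.X 0 * MvPolynomial.C (d i)) := by
  rw [hodgeDen, Matrix.diagonal_map (map_zero _), ← Matrix.diagonal_smul, ← Matrix.diagonal_one,
    Matrix.diagonal_sub, Matrix.det_diagonal]
  rfl

/-- The embedding of the constants into `ℂ(x, y)`. -/
noncomputable def constRatXY : ℂ →+* RatXY :=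
  (algebraMap PolyXY RatXY).comp MvPolynomial.C

/-- The variable `x` of `ℂ(x, y)`. -/
noncomputable def ratX : RatXY :=
  algebraMap PolyXY RatXY (MvPolynomial.X 0)

/-- The variable `y` of `ℂ(x, y)`. -/
noncomputable def ratY : RatXY :=
  algebraMap PolyXY RatXY (MvPolynomial.X 1)

/-- The character `j ↦ ω_q ^ j` with values in the constants of `ℂ(x, y)`. -/
noncomputable def ratAddChar (q : ℕ) [NeZero q] : AddChar (ZMod q) RatXY :=
  constRatXY.toMonoidHom.compAddChar ZMod.stdAddChar

theorem ratAddChar_injective (q : ℕ) [NeZero q] : Function.Injective (ratAddChar q) :=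
  constRatXY.injective.comp ZMod.injective_stdAddChar

theorem one_sub_ratX_mul_constRatXY_ne_zero (c : ℂ) : 1 - ratX * constRatXY c ≠ 0 := by
  have hpoly : (1 - MvPolynomial.X 0 * MvPolynomial.C c : PolyXY) ≠ 0 := fun h => by
    simpa using congrArg (MvPolynomial.eval 0) h
  simpa only [map_sub, map_one, map_mul, ratX, constRatXY, RingHom.comp_apply] using
    (map_ne_zero_iff _ (IsFractionRing.injective PolyXY RatXY)).2 hpoly

theorem hodgeSeries_cyclicL {q : ℕ} [NeZero q] (s : ι → ℤ) :
    hodgeSeries (cyclicL q s) = (q : RatXY)⁻¹ *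
      ∑ k, ∏ i, (1 + ratY * ratAddChar q (k * s i)) / (1 - ratX * ratAddChar q (k * s i)) := by
  rw [hodgeSeries_eq_of_range_eq _ (range_diagOmegaChar q s), ZMod.card]
  refine congrArg _ (Finset.sum_congr rfl fun k _ => ?_)
  rw [coe_diagOmegaChar, hodgeNum_diagonal, hodgeDen_diagonal, map_prod, map_prod,
    ← Finset.prod_div_distrib]
  simp only [map_add, map_sub, map_mul, map_one]
  rfl

theorem hodgeSeries_cyclicL_dub {m q : ℕ} [NeZero q] (s : Fin m → ℤ) :
    hodgeSeries (cyclicL q (dub s)) = (q : RatXY)⁻¹ *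
      ∑ k, ∏ i, hodgeFactor ratX ratY (ratAddChar q (k * s i)) := by
  simp only [hodgeSeries_cyclicL, Fintype.prod_prod_type, Fin.prod_univ_two, dub, if_true,
    one_ne_zero, if_false, Int.cast_neg, mul_neg, AddChar.map_neg_eq_inv, div_mul_div_comm,
    hodgeFactor]

theorem hodgeSeries_LMR {m r t : ℕ} [NeZero (r ^ 2 * t)] (a : Fin m → ℤ) :
    hodgeSeries (LMR r t a) = ((r ^ 2 * t : ℕ) : RatXY)⁻¹ *
      ∑ k, ∏ i, hodgeFactor ratX ratY (ratAddChar (r ^ 2 * t) (k * (r * t * a i + 1))) := by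
  refine (hodgeSeries_cyclicL_dub _).trans ?_
  push_cast
  rfl

theorem natCast_mul_natCast_mul_eq_zero (r t : ℕ) :
    (r : ZMod (r ^ 2 * t)) * (r * t) = 0 := by
  have hself : ((r ^ 2 * t : ℕ) : ZMod (r ^ 2 * t)) = 0 := ZMod.natCast_self _
  push_cast at hself
  linear_combination hself

theorem natCast_mul_mul_self_eq_zero (r t : ℕ) :
    (r * t : ZMod (r ^ 2 * t)) * (r * t) = 0 := by
  linear_combination t * natCast_mul_natCast_mul_eq_zero r t

theorem hodgeEquivalent_LMR_neg {m r t : ℕ} [NeZero (r ^ 2 * t)] {a : Fin m → ℤ}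
    (ha : HereditarilyGoodMod r a) : HodgeEquivalent (LMR r t a) (LMR r t (-a)) := by
  have hr : (r : RatXY) ≠ 0 := fun h =>
    NeZero.ne (r ^ 2 * t) (by simp [Nat.cast_eq_zero.1 h])
  rw [HodgeEquivalent, hodgeSeries_LMR, hodgeSeries_LMR,
    sum_prod_hodgeFactor_neg (ratAddChar_injective _)
      (fun _ => one_sub_ratX_mul_constRatXY_ne_zero _) ratY (natCast_mul_mul_self_eq_zero r t) hr
      (natCast_mul_natCast_mul_eq_zero r t) ha]

end HodgeSeries

section Conjugacy

theorem ConjugateInGL.exists_map_eq {ι : Type*} [Fintype ι] [DecidableEq ι] {q : ℕ} [NeZero q]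
    {s s' : ι → ℤ} (h : ConjugateInGL (cyclicL q s) (cyclicL q s')) :
    ∃ k : ZMod q, (Finset.univ.val.map fun i => (s i : ZMod q)) =
      Finset.univ.val.map fun i => k * (s' i : ZMod q) := by
  obtain ⟨P, hP⟩ := h
  obtain ⟨_, hmem, hconj⟩ := hP.subset ⟨diagOmega q s, Subgroup.mem_zpowers _, rfl⟩
  rw [SetLike.mem_coe, ← range_diagOmegaChar] at hmem
  obtain ⟨k, rfl : diagOmegaChar q s' k.toAdd = _⟩ := hmem
  have hroots : ∀ d : ι → ℂ, (Matrix.diagonal d).charpoly.roots = Finset.univ.val.map d :=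
    fun d => by
      rw [Matrix.charpoly_diagonal,
        ← Polynomial.roots_multiset_prod_X_sub_C (Multiset.map d _), Multiset.map_map]
      rfl
  have hspec := congrArg (fun M : Matrix ι ι ℂ => M.charpoly.roots) hconj
  simp only [coe_diagOmegaChar, coe_diagOmega, Matrix.coe_units_inv, Matrix.charpoly_units_conj,
    hroots] at hspec
  refine ⟨k.toAdd, Multiset.map_injective ZMod.injective_stdAddChar ?_⟩
  simpa only [Multiset.map_map, Function.comp_def] using hspec.symm

theorem map_intCast_dub {R : Type*} [Ring R] {m : ℕ} (s : Fin m → ℤ) :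
    (Finset.univ.val.map fun p => (dub s p : R)) =
      (Finset.univ.val.map fun i => (s i : R)) +
        (Finset.univ.val.map fun i => (s i : R)).map Neg.neg := by
  have hsum : ∀ {κ : Type} [Fintype κ] (g : κ → R),
      Finset.univ.val.map g = ∑ i, ({g i} : Multiset R) := fun g => by
    rw [← Multiset.sum_map_singleton (Multiset.map g _), Multiset.map_map]
    rfl
  rw [Multiset.map_map, hsum, hsum, hsum, Fintype.sum_prod_type, ← Finset.sum_add_distrib]
  simp [dub]

-- The value of `π` tells `v` from `-v`.
theorem eq_of_add_map_neg_eq {R S : Type*} [Ring R] [Ring S] (π : R →+* S) (hS : (-1 : S) ≠ 1)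
    {B C : Multiset R} (hB : ∀ v ∈ B, π v = 1) (hC : ∀ v ∈ C, π v = 1)
    (h : B + B.map Neg.neg = C + C.map Neg.neg) : B = C := by
  classical
  have hfilter : ∀ D : Multiset R, (∀ v ∈ D, π v = 1) →
      (D + D.map Neg.neg).filter (π · = 1) = D := fun D hD => by
    rw [Multiset.filter_add, Multiset.filter_eq_self.2 hD, Multiset.filter_eq_nil.2, add_zero]
    intro _ hmem
    obtain ⟨v, hv, rfl⟩ := Multiset.mem_map.1 hmem
    rwa [map_neg, hD v hv]
  rw [← hfilter B hB, h, hfilter C hC]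

theorem exists_eq_map_mul_of_add_map_neg_eq {R S : Type*} [Ring R] [Ring S] (π : R →+* S)
    (hS : (-1 : S) ≠ 1) {B C : Multiset R} (hB : ∀ v ∈ B, π v = 1) (hC : ∀ v ∈ C, π v = 1)
    {k : R} (h : B + B.map Neg.neg = (C + C.map Neg.neg).map (k * ·)) :
    ∃ l, B = C.map (l * ·) := by
  rcases B.empty_or_exists_mem with rfl | ⟨v, hv⟩
  · have hzero : C = 0 := by simpa using h.symm
    exact ⟨k, by simp [hzero]⟩
  have hmap : ∀ l : R, π l = 1 → ∀ w ∈ C.map (l * ·), π w = 1 := fun l hl _ hmem => by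
    obtain ⟨w, hw, rfl⟩ := Multiset.mem_map.1 hmem
    rw [map_mul, hl, hC w hw, mul_one]
  have hk : π k = 1 ∨ π (-k) = 1 := by
    have hv' := h ▸ Multiset.mem_add.2 (Or.inl hv)
    simp only [Multiset.map_add, Multiset.map_map, Multiset.mem_add, Multiset.mem_map] at hv'
    rcases hv' with ⟨w, hw, rfl⟩ | ⟨w, hw, rfl⟩
    · exact Or.inl (by simpa [hC w hw] using hB _ hv)
    · exact Or.inr (by simpa [hC w hw] using hB _ hv)
  rcases hk with hk | hk
  · refine ⟨k, eq_of_add_map_neg_eq π hS hB (hmap k hk) ?_⟩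
    rw [h, Multiset.map_add, Multiset.map_map, Multiset.map_map]
    simp
  · refine ⟨-k, eq_of_add_map_neg_eq π hS hB (hmap (-k) hk) ?_⟩
    rw [h, Multiset.map_add, Multiset.map_map, Multiset.map_map, add_comm]
    simp

theorem exists_map_mul_add_eq_of_map_eq_map_mul {R ι : Type*} [CommRing R] [Fintype ι] {u l : R}
    (hu : u * u = 0) {a b : ι → ℤ} (h : (Finset.univ.val.map fun i => u * a i + 1) =
      Finset.univ.val.map fun i => l * (u * b i + 1)) :
    ∃ c : ℤ, (Finset.univ.val.map fun i => u * (a i + c : ℤ)) =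
      Finset.univ.val.map fun i => u * b i := by
  obtain ⟨σ, hσ⟩ := map_univ_eq_map_univ_iff.1 h
  rcases isEmpty_or_nonempty ι with hι | ⟨⟨i₀⟩⟩
  · exact ⟨0, map_univ_eq_map_univ_iff.2 ⟨σ, isEmptyElim⟩⟩
  have hl : l = 1 + u * (a i₀ - b (σ i₀)) := by
    linear_combination (1 - u * b (σ i₀)) * hσ i₀ +
      (l * b (σ i₀) ^ 2 - a i₀ * b (σ i₀)) * hu
  refine ⟨b (σ i₀) - a i₀, map_univ_eq_map_univ_iff.2 ⟨σ, fun i => ?_⟩⟩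
  push_cast
  linear_combination hσ i - (u * b (σ i) + 1) * hl - (a i₀ - b (σ i₀)) * b (σ i) * hu

theorem natCast_mul_mul_intCast_inj {r t : ℕ} (hrt : r * t ≠ 0) {x y : ℤ} :
    (r * t * x : ZMod (r ^ 2 * t)) = r * t * y ↔ (x : ZMod r) = y := by
  have hleft : (r * t * x : ZMod (r ^ 2 * t)) = r * t * y ↔
      (((r * t : ℕ) * x : ℤ) : ZMod (r ^ 2 * t)) = ((r * t : ℕ) * y : ℤ) := by
    push_cast
    rfl
  have hmod : ((r ^ 2 * t : ℕ) : ℤ) = (r * t : ℕ) * r := by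
    push_cast
    ring
  rw [hleft, ZMod.intCast_eq_intCast_iff_dvd_sub, ZMod.intCast_eq_intCast_iff_dvd_sub, hmod,
    ← mul_sub, mul_dvd_mul_iff_left (Nat.cast_ne_zero.2 hrt)]

theorem ConjugateInGL.exists_map_mul_add_one_eq {m r t : ℕ} [NeZero (r ^ 2 * t)]
    (hrt : 2 < r * t) {a b : Fin m → ℤ} (h : ConjugateInGL (LMR r t a) (LMR r t b)) :
    ∃ l : ZMod (r ^ 2 * t), (Finset.univ.val.map fun i => (r * t * a i + 1 : ZMod (r ^ 2 * t))) =
      Finset.univ.val.map fun i => l * (r * t * b i + 1) := by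
  have : Fact (2 < r * t) := ⟨hrt⟩
  let π := ZMod.castHom (show r * t ∣ r ^ 2 * t from ⟨r, by ring⟩) (ZMod (r * t))
  have hπ : ∀ c : Fin m → ℤ,
      ∀ v ∈ Finset.univ.val.map fun i => (r * t * c i + 1 : ZMod (r ^ 2 * t)), π v = 1 := by
    intro c _ hv
    obtain ⟨i, -, rfl⟩ := Multiset.mem_map.1 hv
    have hself : (r * t : ZMod (r * t)) = 0 := by exact_mod_cast ZMod.natCast_self (r * t)
    simp [hself]
  have hdub : ∀ c : Fin m → ℤ, (Finset.univ.val.map fun p =>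
      (dub (fun i => (r : ℤ) * t * c i + 1) p : ZMod (r ^ 2 * t))) =
        (Finset.univ.val.map fun i => (r * t * c i + 1 : ZMod (r ^ 2 * t))) +
          (Finset.univ.val.map fun i => (r * t * c i + 1 : ZMod (r ^ 2 * t))).map Neg.neg :=
    fun c => by
      rw [map_intCast_dub]
      push_cast
      rfl
  obtain ⟨k, hk⟩ := h.exists_map_eq
  have hscale := hk.trans (Multiset.map_map (k * ·) _ _).symm
  rw [hdub, hdub] at hscale
  obtain ⟨l, hl⟩ :=
    exists_eq_map_mul_of_add_map_neg_eq π ZMod.neg_one_ne_one (hπ a) (hπ b) hscale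
  exact ⟨l, hl.trans (Multiset.map_map _ _ _)⟩

theorem ConjugateInGL.shiftEqMod {m r t : ℕ} (hrt : 2 < r * t) {a b : Fin m → ℤ}
    (h : ConjugateInGL (LMR r t a) (LMR r t b)) : ShiftEqMod r a b := by
  have hrt₀ : r * t ≠ 0 := by lia
  have : NeZero (r ^ 2 * t) :=
    ⟨by rw [sq, mul_assoc]; exact mul_ne_zero (left_ne_zero_of_mul hrt₀) hrt₀⟩
  obtain ⟨l, hl⟩ := h.exists_map_mul_add_one_eq hrt
  obtain ⟨c, hc⟩ :=
    exists_map_mul_add_eq_of_map_eq_map_mul (natCast_mul_mul_self_eq_zero r t) hl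
  obtain ⟨σ, hσ⟩ := map_univ_eq_map_univ_iff.1 hc
  exact ⟨c, map_univ_eq_map_univ_iff.2
    ⟨σ, fun i => (natCast_mul_mul_intCast_inj hrt₀).1 (hσ i)⟩⟩

theorem reversibleMod_of_dvd_two {m r : ℕ} (hr : r ∣ 2) (a : Fin m → ℤ) : ReversibleMod r a := by
  refine ⟨0, Multiset.map_congr rfl fun i _ => ?_⟩
  rw [ZMod.intCast_eq_intCast_iff_dvd_sub]
  have hdiff : (-a) i - (a i + 0) = 2 * (-a i) := by
    rw [Pi.neg_apply]
    ring
  exact hdiff ▸ (Int.natCast_dvd_natCast.2 hr).mul_right _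

end Conjugacy

theorem theorem1 {m : ℕ} (r : ℕ) (hr : 1 ≤ r) (a : Fin m → ℤ)
    (ha : HereditarilyGoodMod r a) (t : ℕ) (ht : 1 ≤ t) :
    HodgeEquivalent (LMR r t a) (LMR r t (-a)) ∧
      (¬ ReversibleMod r a → ¬ ConjugateInGL (LMR r t a) (LMR r t (-a))) := by
  have : NeZero (r ^ 2 * t) := ⟨by positivity⟩
  refine ⟨hodgeEquivalent_LMR_neg ha, fun hrev hconj => hrev ?_⟩
  rcases Nat.lt_or_ge 2 r with hr₂ | hr₂
  · exact hconj.shiftEqMod (hr₂.trans_le (Nat.le_mul_of_pos_right r ht))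
  · exact reversibleMod_of_dvd_two (by interval_cases r <;> norm_num) a
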